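/- For maps $u,v\colon[0,1]\to\mathbb R$ let $\mathrm{me}_1(u,v)$ be the infimum of all $\lambda>0$ such that the set $\{t:|u(t)-v(t)|>\lambda\}$ has Lebesgue measure less than $\lambda$. For a metric space with a Borel probability measure (an mm-space) $X=(X,d_X,\mu_X)$, a parametrization is a measurable map $f\colon[0,1]\to X$ that pushes Lebesgue measure forward to $\mu_X$, and $L_f=\{p\circ f : p\colon X\to\mathbb R \text{ is 1-Lipschitz}\}$. Gromov's distance $\underline{H}_1\mathcal L\iota(X,Y)$ is the infimum, over all parametrizations $f$ of $X$ and $g$ of $Y$, of the Hausdorff distance between $L_f$ and $L_g$ with respect to $\mathrm{me}_1$ (equivalently, 1-Lipschitz functions are compared modulo additive constants). **Lemma.** Let $G$ be a metrizable topological group which is, as a topological group, a semidirect product $G=H\ltimes N$ of a compact subgroup $H$ and a closed normal subgroup $N$. Assume that $N$ is a Lévy group via a family $(K_\alpha)$ of compact subgroups of $N$, directed by inclusion: $\bigcup_\alpha K_\alpha$ is dense in $N$, and the normalized Haar measures $\mu_\alpha$ of $K_\alpha$ concentrate with respect to the right uniform structure of $G$. The latter means that whenever $A_\alpha\subseteq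 G$ are Borel sets with $\liminf_\alpha\mu_\alpha(A_\alpha)>0$ and $V$ is an entourage of the right uniform structure, which has the basic entourages $\{(x,y): xy^{-1}\in U\}$ with $U$ a neighbourhood of the identity, one has $\mu_\alpha(V[A_\alpha])\to 1$, where $V[A]=\{x:\exists a\in A,\ (x,a)\in V\}$. Let $\nu$ be the normalized Haar measure on $H$. Then there exists a metric $\rho$ on $G$, compatible with the topology and right-invariant ($\rho(xg,yg)=\rho(x,y)$ for all $x,y,g\in G$), such that the mm-spaces $H\cdot K_\alpha=\{hk : h\in H,\ k\in K_\alpha\}$, with the restriction of $\rho$ and the convolution $\nu*\mu_\alpha$, concentrate to $(H,\rho|_H,\nu)$: $$\underline{H}_1\mathcal L\iota\bigl((H\cdot K_\alpha,\rho,\nu*\mu_\alpha),\,(H,\rho|_H,\nu)\bigr)\longrightarrow 0 .$$ If, in addition, each $K_\alpha$ is invariant under the action of $H$ by conjugations, then every $H\cdot K_\alpha$ is a compact subgroup of $G$. -/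

import Mathlib

open Set Filter Topology MeasureTheory
open scoped ENNReal Pointwise

noncomputable section

namespace Concentration

/-- A net `(μ α)` of measures on a uniform space has the Lévy concentration property:
if `A α` are Borel sets with `liminf μ α (A α) > 0`, then `μ α (V[A α]) → 1` for every
entourage `V`, where `V[A] = {x | ∃ a ∈ A, (x, a) ∈ V}`. -/
def Concentrates {X : Type*} [UniformSpace X] [MeasurableSpace X] {ι : Type*} [Preorder ι]
    (μ : ι → Measure X) : Prop :=
  ∀ A : ι → Set X, (∀ α, MeasurableSet (A α)) → 0 < liminf (fun α => μ α (A α)) atTop →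
    ∀ V ∈ uniformity X,
      Tendsto (fun α => μ α {x | ∃ a ∈ A α, (x, a) ∈ V}) atTop (𝓝 1)

/-- The normalized Haar measure of a compact subgroup `K`, as a measure on `K`. -/
def haarProb {G : Type*} [Group G] [TopologicalSpace G] [IsTopologicalGroup G]
    [MeasurableSpace G] [BorelSpace G] (K : Subgroup G) [CompactSpace K] : Measure K :=
  Measure.haarMeasure ⊤

/-- `G = H ⋉ N` as a topological group: `N` is a closed normal subgroup, and `(h, x) ↦ h x` is a
homeomorphism of `H × N` onto `G`. -/
structure IsSemidirect {G : Type*} [Group G] [TopologicalSpace G] (H N : Subgroup G) : Prop where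
  normal : N.Normal
  isClosed : IsClosed (N : Set G)
  isHomeomorph : IsHomeomorph (fun p : H × N => (p.1 : G) * (p.2 : G))

/-- The subgroup `N` of `G` is a Lévy group via the net `(K α)`, directed by inclusion, of compact
subgroups of `N`: their union is dense in `N`, and the normalized Haar measures of the `K α`,
regarded as measures on `G`, concentrate for the right uniform structure, whose basic entourages
are `{(x, y) | x * y⁻¹ ∈ V}` with `V` a neighbourhood of the identity. -/
structure IsLevyVia {G : Type*} [Group G] [TopologicalSpace G] [IsTopologicalGroup G]
    [MeasurableSpace G] [BorelSpace G] {ι : Type*} [Preorder ι]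
    (N : Subgroup G) (K : ι → Subgroup G) [∀ α, CompactSpace (K α)] : Prop where
  mono : Monotone K
  le : ∀ α, K α ≤ N
  dense : (N : Set G) ⊆ closure (⋃ α, (K α : Set G))
  concentrates : @Concentrates G (IsTopologicalGroup.rightUniformSpace G) _ ι _
    (fun α => (haarProb (K α)).map Subtype.val)

/-- The convolution of the normalized Haar measures of `H` and `K`, as a measure on the set
`H * K` that carries it: the law of `h * k` for independent Haar-random `h ∈ H`, `k ∈ K`. -/
def haarConv {G : Type*} [Group G] [TopologicalSpace G] [IsTopologicalGroup G]
    [MeasurableSpace G] [BorelSpace G] (H K : Subgroup G) [CompactSpace H] [CompactSpace K] :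
    Measure ((H : Set G) * (K : Set G) : Set G) :=
  ((haarProb H).prod (haarProb K)).map
    (fun p : H × K => ⟨(p.1 : G) * (p.2 : G), Set.mul_mem_mul p.1.2 p.2.2⟩)

/-- The distance `me₁` of convergence in measure between real functions on `[0, 1]`:
the infimum of all `l > 0` such that `{t | |u t - v t| > l}` has Lebesgue measure `< l`. -/
def me₁ (u v : unitInterval → ℝ) : ℝ≥0∞ :=
  ⨅ (l : ℝ) (_ : 0 < l ∧
    (volume : Measure unitInterval) {t | l < |u t - v t|} < ENNReal.ofReal l), ENNReal.ofReal l

/-- The Hausdorff distance between two sets of functions with respect to `me₁`. -/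
def hausdorffMe₁ (A B : Set (unitInterval → ℝ)) : ℝ≥0∞ :=
  (⨆ u ∈ A, ⨅ v ∈ B, me₁ u v) ⊔ (⨆ v ∈ B, ⨅ u ∈ A, me₁ u v)

/-- `f : [0, 1] → X` is a parametrization of `(X, μ)`: it is measurable and pushes Lebesgue
measure forward to `μ`. -/
def IsParam {X : Type*} [MeasurableSpace X] (μ : Measure X) (f : unitInterval → X) : Prop :=
  Measurable f ∧ (volume : Measure unitInterval).map f = μ

/-- The functions `p ∘ f` on `[0, 1]`, with `p : X → ℝ` 1-Lipschitz for the metric `d` on `X`. -/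
def lipSet {X : Type*} (d : X → X → ℝ) (f : unitInterval → X) : Set (unitInterval → ℝ) :=
  {u | ∃ p : X → ℝ, (∀ x y, |p x - p y| ≤ d x y) ∧ u = p ∘ f}

/-- Gromov's distance `H₁Lι` between the mm-spaces `(X, d, μ)` and `(Y, e, ν)`: the infimum, over
all parametrizations `f`, `g` of the two spaces, of the `me₁`-Hausdorff distance between the sets
of 1-Lipschitz functions on `X` and on `Y`, read on `[0, 1]`. The functions are not normalized;
as both sets are stable under adding constants, this is the same as comparing them modulo
constants. The value is `∞` if there is no parametrization. -/
def gromovDist {X Y : Type*} [MeasurableSpace X] [MeasurableSpace Y]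
    (d : X → X → ℝ) (μ : Measure X) (e : Y → Y → ℝ) (ν : Measure Y) : ℝ≥0∞ :=
  ⨅ (f : unitInterval → X) (_ : IsParam μ f) (g : unitInterval → Y) (_ : IsParam ν g),
    hausdorffMe₁ (lipSet d f) (lipSet e g)

/-- `ρ` is a metric on the group `G` that induces the given topology and satisfies
`ρ (x * g, y * g) = ρ (x, y)`. -/
def IsCompatibleRightInvariant {G : Type*} [Group G] [t : TopologicalSpace G]
    (ρ : MetricSpace G) : Prop :=
  ρ.toUniformSpace.toTopologicalSpace = t ∧ ∀ x y g : G, ρ.dist (x * g) (y * g) = ρ.dist x y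

end Concentration

end

/-! Let `π` be the projection of `G` onto `H` along `N`. Suppose that `ρ` is invariant under right
translations and under left translations by `H`, and that `π` is nonexpansive. Parametrize `H * K`
and `H` together by independent Haar-random `(h, k)`, read as `h * k` and as `h`. A 1-Lipschitz `q`
on `H` is matched exactly by `q ∘ π`. Given a 1-Lipschitz `p` on `H * K`, left invariance makes each
fibre function `k ↦ p (h * k)` 1-Lipschitz on `K`, so by concentration it is nearly constant, close
to its median `m h`; right invariance makes `m` 1-Lipschitz on `H`. This is
`gromovDist_haarConv_le`.

The metric comes from `exists_metric_of_retraction`: a supremum of a truncated pseudometric over all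
the maps to be made nonexpansive, which keeps the topology because `H` is compact. The estimate must
be uniform in `p` and `h`, which `Concentrates.eventually_forall` provides. -/

namespace Concentration

/-! ### An invariant metric for which a retraction is nonexpansive -/

variable {G : Type*} [Group G] [TopologicalSpace G]

/-- The right uniform structure of a metrizable group is given by a pseudometric. -/
theorem exists_pseudometric_rightUniform [IsTopologicalGroup G]
    [TopologicalSpace.MetrizableSpace G] :
    ∃ d : G → G → ℝ, (∀ x, d x x = 0) ∧ (∀ x y, d x y = d y x) ∧
      (∀ x y z, d x z ≤ d x y + d y z) ∧ (∀ x y, 0 ≤ d x y) ∧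
      (∀ ε > 0, ∀ᶠ z in 𝓝 (1 : G), ∀ x y, x * y⁻¹ = z → d x y < ε) ∧
      ∀ x, ∀ s ∈ 𝓝 x, ∃ ε > 0, ∀ y, d x y < ε → y ∈ s := by
  let u : UniformSpace G := IsTopologicalGroup.rightUniformSpace G
  have hu : uniformity G = comap (fun p : G × G => p.2 * p.1⁻¹) (𝓝 1) := rfl
  have : IsCountablyGenerated (uniformity G) := by
    rw [hu]; infer_instance
  let m : PseudoMetricSpace G := UniformSpace.pseudoMetricSpace G
  refine ⟨dist, dist_self, dist_comm, dist_triangle, fun _ _ => dist_nonneg, ?_, ?_⟩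
  · intro ε hε
    have h : {p : G × G | dist p.1 p.2 < ε} ∈ uniformity G := Metric.dist_mem_uniformity hε
    rw [hu] at h
    obtain ⟨t, ht, hts⟩ := h
    filter_upwards [ht] with z hz x y hxy
    rw [dist_comm]
    exact hts (a := (y, x)) (show x * y⁻¹ ∈ t from hxy ▸ hz)
  · intro x s hs
    obtain ⟨ε, hε, h⟩ := Metric.mem_nhds_iff.1 hs
    exact ⟨ε, hε, fun y hy => h (by rwa [Metric.mem_ball, dist_comm])⟩

/-- Conjugates by elements of a compact subgroup are uniformly small near the identity. -/
theorem eventually_conj_mem [IsTopologicalGroup G] (H : Subgroup G) [CompactSpace H] (f : G → G)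
    (hf : ContinuousAt f 1) (h1 : f 1 = 1) {U : Set G} (hU : U ∈ 𝓝 1) :
    ∀ᶠ z in 𝓝 (1 : G), ∀ h ∈ H, h * f z * h⁻¹ ∈ U := by
  have hH : IsCompact (H : Set G) := isCompact_iff_compactSpace.2 ‹_›
  refine hH.eventually_forall_of_forall_eventually
    (P := fun z h => h * f z * h⁻¹ ∈ U) fun h _ => ?_
  have hc : ContinuousAt (fun z : G × G => z.2 * f z.1 * z.2⁻¹) (1, h) :=
    (continuousAt_snd.mul (hf.comp_of_eq continuousAt_fst rfl)).mul continuousAt_snd.inv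
  refine hc.eventually_mem ?_
  simpa [h1] using hU

/-- A metrizable group with a compact subgroup `H` and a continuous retraction homomorphism `π`
commuting with translations by `H` carries a compatible right-invariant metric that is invariant
under left translations by `H` and for which `π` is 1-Lipschitz. -/
theorem exists_metric_of_retraction [IsTopologicalGroup G]
    [TopologicalSpace.MetrizableSpace G]
    (H : Subgroup G) [CompactSpace H] (π : G →* G) (hπ : Continuous π)
    (hππ : ∀ x, π (π x) = π x) (hπH : ∀ h ∈ H, π h = h) :
    ∃ ρ : MetricSpace G, IsCompatibleRightInvariant ρ ∧
      (∀ h ∈ H, ∀ x y, ρ.dist (h * x) (h * y) = ρ.dist x y) ∧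
      ∀ x y, ρ.dist (π x) (π y) ≤ ρ.dist x y := by
  obtain ⟨d, d0, dsymm, dtri, dnn, dsmall, dnhds⟩ := exists_pseudometric_rightUniform (G := G)
  let σ : Bool → G →* G := fun b => if b then π else MonoidHom.id G
  have σcont : ∀ b, Continuous (σ b) := by
    intro b; cases b
    · exact continuous_id
    · exact hπ
  have σH : ∀ b, ∀ h ∈ H, σ b h = h := by
    intro b; cases b
    · exact fun h _ => rfl
    · exact hπH
  -- The three indices give, in turn, right invariance, left `H`-invariance and nonexpansiveness of
  -- `π`. Truncation at 1 keeps the supremum finite although `G` need not be compact.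
  let φ : G × H × Bool → G → G := fun i x => i.2.1 * σ i.2.2 x * i.1
  let D : G → G → ℝ := fun x y => ⨆ i, min 1 (d (φ i x) (φ i y))
  have bdd : ∀ x y, BddAbove (range fun i => min 1 (d (φ i x) (φ i y))) := fun x y =>
    ⟨1, by rintro _ ⟨i, rfl⟩; exact min_le_left _ _⟩
  have le_D : ∀ x y i, min 1 (d (φ i x) (φ i y)) ≤ D x y := fun x y i => le_ciSup (bdd x y) i
  have D_le : ∀ x y c, (∀ i, min 1 (d (φ i x) (φ i y)) ≤ c) → D x y ≤ c := fun x y c h =>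
    ciSup_le h
  have dD : ∀ x y, min 1 (d x y) ≤ D x y := fun x y => by
    simpa [φ, σ] using le_D x y (1, 1, false)
  have Dsmall : ∀ ε > 0, ∀ᶠ z in 𝓝 (1 : G), ∀ x y, x * y⁻¹ = z → D x y < ε := by
    intro ε hε
    have key := fun b => eventually_conj_mem H (σ b) (σcont b).continuousAt (map_one _)
      (dsmall (ε / 2) (half_pos hε))
    filter_upwards [key false, key true] with z hf ht x y hxy
    refine (D_le x y (ε / 2) ?_).trans_lt (half_lt_self hε)
    rintro ⟨g, h, b⟩
    refine (min_le_right _ _).trans (le_of_lt ?_)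
    -- The right translation by `g` cancels in the quotient of the two images, leaving the conjugate
    -- `h * σ b (x * y⁻¹) * h⁻¹`.
    have hz : (h : G) * σ b z * (h : G)⁻¹ ∈
        {z : G | ∀ x y, x * y⁻¹ = z → d x y < ε / 2} := by
      cases b
      · exact hf h h.2
      · exact ht h h.2
    refine hz _ _ ?_
    simp only [φ, ← hxy, map_mul, map_inv]
    group
  have Dinv : ∀ x y g, D (x * g) (y * g) = D x y := by
    have le : ∀ x y g, D (x * g) (y * g) ≤ D x y := by
      intro x y g
      refine D_le _ _ _ ?_
      rintro ⟨a, h, b⟩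
      simpa [φ, mul_assoc] using le_D x y (σ b g * a, h, b)
    intro x y g
    refine le_antisymm (le x y g) ?_
    simpa using le (x * g) (y * g) g⁻¹
  have DH : ∀ h ∈ H, ∀ x y, D (h * x) (h * y) = D x y := by
    have le : ∀ h ∈ H, ∀ x y, D (h * x) (h * y) ≤ D x y := by
      intro h hh x y
      refine D_le _ _ _ ?_
      rintro ⟨a, k, b⟩
      simpa [φ, mul_assoc, σH b h hh] using le_D x y (a, k * ⟨h, hh⟩, b)
    intro h hh x y
    refine le_antisymm (le h hh x y) ?_
    simpa using le h⁻¹ (inv_mem hh) (h * x) (h * y)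
  have Dπ : ∀ x y, D (π x) (π y) ≤ D x y := by
    intro x y
    refine D_le _ _ _ ?_
    rintro ⟨a, k, b⟩
    -- Both `id` and `π` become `π` after composition with `π`, so the family of maps is stable.
    have : ∀ x, σ b (π x) = σ true x := by
      intro x; cases b
      · rfl
      · exact hππ x
    simpa [φ, this] using le_D x y (a, k, true)
  have Dnhds : ∀ x, ∀ s ∈ 𝓝 x, ∃ ε > 0, ∀ y, D x y < ε → y ∈ s := by
    intro x s hs
    obtain ⟨ε, hε, h⟩ := dnhds x s hs
    refine ⟨min 1 ε, lt_min one_pos hε, fun y hy => h y ?_⟩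
    have h1 := (dD x y).trans_lt hy
    rcases min_lt_iff.1 h1 with h2 | h2
    · exact absurd h2 (not_lt.2 (min_le_left _ _))
    · exact h2.trans_le (min_le_right _ _)
  have D0 : ∀ x, D x x = 0 := fun x => by simp [D, d0]
  have Dsymm : ∀ x y, D x y = D y x := fun x y => by simp only [D, dsymm]
  refine ⟨MetricSpace.ofDistTopology D D0 Dsymm ?_ ?_ ?_, ⟨rfl, Dinv⟩, DH, Dπ⟩
  · intro x y z
    refine D_le _ _ _ fun i => ?_
    have h1 := le_D x y i
    have h2 := le_D y z i
    have h3 := dtri (φ i x) (φ i y) (φ i z)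
    have h4 := dnn (φ i x) (φ i y)
    have h5 := dnn (φ i y) (φ i z)
    refine le_trans ?_ (add_le_add h1 h2)
    rcases min_cases 1 (d (φ i x) (φ i y)) with h | h <;>
    rcases min_cases 1 (d (φ i y) (φ i z)) with h' | h' <;>
    rw [h.1, h'.1] <;> first
      | exact (min_le_right _ _).trans h3
      | (refine (min_le_left _ _).trans ?_; linarith)
  · intro s
    rw [isOpen_iff_mem_nhds]
    refine ⟨fun h x hx => Dnhds x s (h x hx), fun h x hx => ?_⟩
    obtain ⟨ε, hε, hs⟩ := h x hx
    have hc : Tendsto (fun y => x * y⁻¹) (𝓝 x) (𝓝 1) := by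
      have : ContinuousAt (fun y => x * y⁻¹) x := by fun_prop
      simpa [ContinuousAt] using this
    filter_upwards [hc.eventually (Dsmall ε hε)] with y hy
    exact hs y (hy x y rfl)
  · intro x y hxy
    by_contra hne
    obtain ⟨ε, hε, h⟩ := Dnhds x {y}ᶜ (isOpen_compl_singleton.mem_nhds hne)
    exact h y (hxy ▸ hε) rfl

/-! ### Semidirect products and products of compact subgroups -/

/-- In a semidirect product `H ⋉ N`, the projection onto `H` is a continuous homomorphism. -/
theorem IsSemidirect.exists_projection {H N : Subgroup G} (hHN : IsSemidirect H N) :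
    ∃ π : G →* G, Continuous π ∧ (∀ x, π x ∈ H) ∧ (∀ h ∈ H, π h = h) ∧ ∀ n ∈ N, π n = 1 := by
  have := hHN.normal
  let e := hHN.isHomeomorph.homeomorph
  have he : ∀ p : H × N, e p = (p.1 : G) * p.2 := fun p => rfl
  have es : ∀ (h : H) (n : N), ((e.symm ((h : G) * n)).1 : G) = h := fun h n => by
    rw [← he (h, n), e.symm_apply_apply]
  have split : ∀ x, ∃ (h : H) (n : N), x = (h : G) * n := fun x =>
    ⟨(e.symm x).1, (e.symm x).2, by rw [← he, e.apply_symm_apply]⟩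
  have conj : ∀ (h : H) (n : N), (h : G)⁻¹ * n * h ∈ N := fun h n => by
    simpa using this.conj_mem n n.2 (h : G)⁻¹
  let π : G →* G :=
    { toFun := fun x => (e.symm x).1
      map_one' := by simpa using es 1 1
      map_mul' := fun x y => by
        obtain ⟨h, n, rfl⟩ := split x
        obtain ⟨k, m, rfl⟩ := split y
        have : (h : G) * n * (k * m) =
            ((h * k : H) : G) * ((⟨(k : G)⁻¹ * n * k, conj k n⟩ * m : N) : G) := by
          simp only [Subgroup.coe_mul]; group
        rw [this, es, es, es, Subgroup.coe_mul] }
  have hcont : Continuous fun x : G => ((e.symm x).1 : G) := by fun_prop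
  refine ⟨π, hcont, fun x => (e.symm x).1.2, fun h hh => ?_, fun n hn => ?_⟩
  · simpa [π] using es ⟨h, hh⟩ 1
  · simpa [π] using es 1 ⟨n, hn⟩

/-- Needed for parametrizations by `[0, 1]` to exist, and for continuous maps on `H × K` to be
measurable for the product σ-algebra. -/
theorem polishSpace_subgroup [TopologicalSpace.MetrizableSpace G] (H : Subgroup G)
    [CompactSpace H] : PolishSpace H := by
  have : TopologicalSpace.MetrizableSpace H := Topology.IsEmbedding.subtypeVal.metrizableSpace
  let := TopologicalSpace.metrizableSpaceMetric H
  infer_instance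

/-- The product of a compact subgroup `H` with a compact subgroup normalized by `H` is a compact
subgroup. -/
theorem exists_compact_subgroup_eq_mul [IsTopologicalGroup G] (H K : Subgroup G)
    [CompactSpace H] [CompactSpace K]
    (hHK : ∀ h ∈ H, ∀ k ∈ K, h * k * h⁻¹ ∈ K) :
    ∃ L : Subgroup G, (L : Set G) = (H : Set G) * (K : Set G) ∧ IsCompact (L : Set G) := by
  have hcompact : IsCompact ((H : Set G) * (K : Set G)) :=
    (isCompact_iff_compactSpace.2 ‹CompactSpace H›).mul
      (isCompact_iff_compactSpace.2 ‹CompactSpace K›)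
  have hle : H ≤ Subgroup.normalizer (K : Set G) := by
    intro h hh
    rw [Subgroup.mem_normalizer_iff]
    refine fun k => ⟨hHK h hh k, fun hk => ?_⟩
    simpa [mul_assoc] using hHK h⁻¹ (inv_mem hh) _ hk
  have hL : ((H ⊔ K : Subgroup G) : Set G) = (H : Set G) * (K : Set G) :=
    Subgroup.coe_mul_of_left_le_normalizer_right H K hle
  exact ⟨H ⊔ K, hL, hL ▸ hcompact⟩

/-! ### Medians of bounded functions -/

section Median

variable {X : Type*} [MeasurableSpace X]

/-- A median of a real function. -/
noncomputable def median (μ : Measure X) (f : X → ℝ) : ℝ :=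
  sInf {t | 1 / 2 ≤ μ {x | f x ≤ t}}

variable (μ : Measure X) {f g : X → ℝ}

theorem median_set_nonempty [IsProbabilityMeasure μ] (hf : BddAbove (range f)) :
    {t | 1 / 2 ≤ μ {x | f x ≤ t}}.Nonempty := by
  obtain ⟨b, hb⟩ := hf
  refine ⟨b, ?_⟩
  have : {x | f x ≤ b} = univ := eq_univ_of_forall fun x => hb (mem_range_self x)
  simp [this]

theorem median_set_bddBelow (hf : BddBelow (range f)) :
    BddBelow {t | 1 / 2 ≤ μ {x | f x ≤ t}} := by
  obtain ⟨b, hb⟩ := hf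
  refine ⟨b, fun t ht => ?_⟩
  by_contra! hlt
  have : {x | f x ≤ t} = ∅ := eq_empty_of_forall_notMem fun x hx =>
    (hlt.trans_le (hb (mem_range_self x))).not_ge hx
  simp [this] at ht

/-- The slack `ε` avoids asking whether the infimum defining the median is attained. -/
theorem half_le_measure_le_median_add [IsProbabilityMeasure μ] (hf : BddAbove (range f)) {ε : ℝ} (hε : 0 < ε) :
    1 / 2 ≤ μ {x | f x ≤ median μ f + ε} := by
  obtain ⟨t, ht, hlt⟩ := exists_lt_of_csInf_lt (median_set_nonempty μ hf)
    (lt_add_of_pos_right (median μ f) hε)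
  exact le_trans ht (measure_mono fun x (hx : f x ≤ t) => hx.trans hlt.le)

theorem half_le_measure_median_sub_le [IsProbabilityMeasure μ] (hf : BddBelow (range f)) {ε : ℝ} (hε : 0 < ε) :
    1 / 2 ≤ μ {x | median μ f - ε ≤ f x} := by
  have h1 : μ {x | f x ≤ median μ f - ε} < 1 / 2 := by
    by_contra! h
    have : median μ f ≤ median μ f - ε := csInf_le (median_set_bddBelow μ hf) h
    linarith
  have h2 : (1 : ℝ≥0∞) ≤ μ {x | f x ≤ median μ f - ε} + μ {x | median μ f - ε ≤ f x} := by
    rw [← measure_univ (μ := μ)]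
    refine le_trans (measure_mono fun x _ => ?_) (measure_union_le _ _)
    exact le_total (f x) (median μ f - ε)
  by_contra! h3
  have h4 := h2.trans_lt (ENNReal.add_lt_add h1 h3)
  rw [ENNReal.add_halves] at h4
  exact lt_irrefl _ h4

/-- This monotonicity is what makes the fibrewise median 1-Lipschitz on `H`. -/
theorem median_le_median_add [IsProbabilityMeasure μ] (hf : BddBelow (range f)) (hg : BddAbove (range g)) {c : ℝ}
    (h : ∀ x, f x ≤ g x + c) : median μ f ≤ median μ g + c := by
  rw [← sub_le_iff_le_add]
  refine le_csInf (median_set_nonempty μ hg) fun t ht => ?_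
  rw [sub_le_iff_le_add]
  exact csInf_le (median_set_bddBelow μ hf) (le_trans ht
    (measure_mono fun x (hx : g x ≤ t) => (h x).trans (by linarith)))

end Median

/-! ### Uniform concentration and compatible metrics -/

/-- The concentration property is uniform over all sets of measure at least `c`. -/
theorem Concentrates.eventually_forall {X : Type*} [UniformSpace X] [MeasurableSpace X]
    {ι : Type*} [Preorder ι] {μ : ι → Measure X} [∀ α, IsProbabilityMeasure (μ α)]
    (hμ : Concentrates μ) {c r : ℝ≥0∞} (hc : 0 < c) (hc1 : c ≤ 1) (hr : r < 1)
    {V : Set (X × X)} (hV : V ∈ uniformity X) :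
    ∀ᶠ α in atTop, ∀ A, MeasurableSet A → c ≤ μ α A →
      r < μ α {x | ∃ a ∈ A, (x, a) ∈ V} := by
  classical
  let bad : ι → Set X → Prop := fun α A =>
    MeasurableSet A ∧ c ≤ μ α A ∧ μ α {x | ∃ a ∈ A, (x, a) ∈ V} ≤ r
  -- Pick a counterexample at each index that has one, and the whole space elsewhere. Concentration
  -- applied to this single net rules out counterexamples eventually.
  let A : ι → Set X := fun α => if h : ∃ A, bad α A then h.choose else univ
  have hA : ∀ α, MeasurableSet (A α) ∧ c ≤ μ α (A α) := by
    intro α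
    by_cases h : ∃ A, bad α A
    · simp only [A, dif_pos h]
      exact ⟨h.choose_spec.1, h.choose_spec.2.1⟩
    · simp only [A, dif_neg h]
      exact ⟨MeasurableSet.univ, by simpa using hc1⟩
  have hlim := hμ A (fun α => (hA α).1)
    (hc.trans_le (le_liminf_of_le (by isBoundedDefault) (Eventually.of_forall fun α => (hA α).2)))
    V hV
  filter_upwards [hlim.eventually_const_lt hr] with α hα B hB hcB
  by_contra! hle
  have h : ∃ A, bad α A := ⟨B, hB, hcB, hle⟩
  have hAα : A α = h.choose := dif_pos h
  rw [hAα] at hα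
  exact hα.not_ge h.choose_spec.2.2

variable [IsTopologicalGroup G]

theorem IsCompatibleRightInvariant.continuous_dist {ρ : MetricSpace G}
    (hρ : IsCompatibleRightInvariant ρ) : Continuous fun p : G × G => ρ.dist p.1 p.2 := by
  obtain ⟨h, -⟩ := hρ
  subst h
  exact _root_.continuous_dist

/-- Right invariance gives `ρ (x, y) = ρ (1, y * x⁻¹)`, so the Lévy hypothesis applies to
`ρ`-neighbourhoods. -/
theorem IsCompatibleRightInvariant.mem_uniformity {ρ : MetricSpace G}
    (hρ : IsCompatibleRightInvariant ρ) {ε : ℝ} (hε : 0 < ε) :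
    {p : G × G | ρ.dist p.1 p.2 < ε} ∈
      @uniformity G (IsTopologicalGroup.rightUniformSpace G) := by
  have hc : Continuous fun z : G => ρ.dist 1 z :=
    hρ.continuous_dist.comp (continuous_const.prodMk continuous_id)
  refine ⟨{z | ρ.dist 1 z < ε}, (isOpen_lt hc continuous_const).mem_nhds ?_, ?_⟩
  · simpa [ρ.dist_self] using hε
  · rintro ⟨x, y⟩ h
    have := hρ.2 1 (y * x⁻¹) x
    simp only [one_mul, inv_mul_cancel_right] at this
    simpa [this] using h

/-- A function that is 1-Lipschitz for a continuous distance is continuous. -/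
theorem continuous_of_abs_sub_le {X : Type*} [TopologicalSpace X] {d : X → X → ℝ}
    (hd : Continuous fun p : X × X => d p.1 p.2) (d0 : ∀ x, d x x = 0) {p : X → ℝ}
    (hp : ∀ x y, |p x - p y| ≤ d x y) : Continuous p := by
  rw [continuous_iff_continuousAt]
  intro x
  rw [ContinuousAt, tendsto_iff_dist_tendsto_zero]
  have hc : Continuous fun y => d y x := hd.comp (continuous_id.prodMk continuous_const)
  have h0 : Tendsto (fun y => d y x) (𝓝 x) (𝓝 0) := by
    simpa [d0] using hc.tendsto x
  exact squeeze_zero (fun _ => dist_nonneg) (fun y => hp y x) h0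

/-- The multiplication map `H × K → H * K`. -/
def mulMap (H K : Subgroup G) (p : H × K) : ((H : Set G) * (K : Set G) : Set G) :=
  ⟨(p.1 : G) * (p.2 : G), Set.mul_mem_mul p.1.2 p.2.2⟩

theorem continuous_mulMap (H K : Subgroup G) : Continuous (mulMap H K) := by
  unfold mulMap
  fun_prop

variable [MeasurableSpace G] [BorelSpace G]

instance haarProb.instIsProbabilityMeasure (K : Subgroup G) [CompactSpace K] :
    IsProbabilityMeasure (haarProb K) := by
  refine ⟨?_⟩
  simpa [haarProb] using Measure.haarMeasure_self (K₀ := (⊤ : TopologicalSpace.PositiveCompacts K))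

instance haarProb.instIsProbabilityMeasureMap (K : Subgroup G) [CompactSpace K] :
    IsProbabilityMeasure ((haarProb K).map (Subtype.val : K → G)) :=
  Measure.isProbabilityMeasure_map measurable_subtype_coe.aemeasurable

/-! ### Concentration of Lipschitz functions around the median -/

/-- One-sided concentration of 1-Lipschitz functions on a compact subgroup. -/
theorem haarProb_setOf_add_le_le [T2Space G] (K : Subgroup G) [CompactSpace K]
    {d : G → G → ℝ} (hd : Continuous fun p : G × G => d p.1 p.2) (d0 : ∀ x, d x x = 0)
    {ε : ℝ} {δ : ℝ≥0∞}
    (hconc : ∀ A, MeasurableSet A → 1 / 2 ≤ (haarProb K).map Subtype.val A →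
      1 - δ < (haarProb K).map Subtype.val {x | ∃ a ∈ A, (x, a) ∈ {p : G × G | d p.1 p.2 < ε}})
    {φ : K → ℝ} (hφ : ∀ x y : K, |φ x - φ y| ≤ d x y) {c : ℝ}
    (hc : 1 / 2 ≤ haarProb K {x | φ x ≤ c}) :
    haarProb K {x | c + ε ≤ φ x} ≤ δ := by
  have hφc : Continuous φ := continuous_of_abs_sub_le (d := fun x y : K => d x y)
    (hd.comp (continuous_subtype_val.prodMap continuous_subtype_val)) (fun x => d0 x) hφ
  have hcl : IsClosed {x | φ x ≤ c} := isClosed_le hφc continuous_const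
  let A : Set G := Subtype.val '' {x : K | φ x ≤ c}
  have hA : MeasurableSet A := (hcl.isCompact.image continuous_subtype_val).isClosed.measurableSet
  have hpre : (Subtype.val : K → G) ⁻¹' A = {x | φ x ≤ c} :=
    preimage_image_eq _ Subtype.val_injective
  have hopen : IsOpen {x | ∃ a ∈ A, (x, a) ∈ {p : G × G | d p.1 p.2 < ε}} := by
    have : {x | ∃ a ∈ A, (x, a) ∈ {p : G × G | d p.1 p.2 < ε}} = ⋃ a ∈ A, {x | d x a < ε} := by
      ext x; simp
    rw [this]
    exact isOpen_biUnion fun a _ => isOpen_lt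
      (hd.comp (continuous_id.prodMk continuous_const)) continuous_const
  have h := hconc A hA (by rwa [Measure.map_apply measurable_subtype_coe hA, hpre])
  rw [Measure.map_apply measurable_subtype_coe hopen.measurableSet] at h
  have h2 := prob_compl_le_one_sub_of_le_prob h.le
    (measurable_subtype_coe hopen.measurableSet)
  -- Where `c + ε ≤ φ`, the point lies outside the `ε`-neighbourhood of `{φ ≤ c}`, whose complement
  -- has mass at most `1 - (1 - δ) ≤ δ`.
  refine (measure_mono ?_).trans (h2.trans tsub_tsub_le)
  rintro x hx ⟨a, ⟨k, hk, rfl⟩, hxk⟩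
  have h3 := (le_abs_self _).trans (hφ x k)
  have hxk' : d x k < ε := hxk
  have hk' : φ k ≤ c := hk
  have hx' : c + ε ≤ φ x := hx
  linarith

/-- Two-sided concentration of 1-Lipschitz functions around the median. -/
theorem haarProb_setOf_lt_abs_sub_median_le [T2Space G] (K : Subgroup G) [CompactSpace K]
    {d : G → G → ℝ} (hd : Continuous fun p : G × G => d p.1 p.2) (d0 : ∀ x, d x x = 0)
    {ε : ℝ} (hε : 0 < ε) {δ : ℝ≥0∞}
    (hconc : ∀ A, MeasurableSet A → 1 / 2 ≤ (haarProb K).map Subtype.val A →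
      1 - δ < (haarProb K).map Subtype.val {x | ∃ a ∈ A, (x, a) ∈ {p : G × G | d p.1 p.2 < ε}})
    {φ : K → ℝ} (hφ : ∀ x y : K, |φ x - φ y| ≤ d x y) :
    haarProb K {x | 2 * ε < |φ x - median (haarProb K) φ|} ≤ δ + δ := by
  have hφc : Continuous φ := continuous_of_abs_sub_le (d := fun x y : K => d x y)
    (hd.comp (continuous_subtype_val.prodMap continuous_subtype_val)) (fun x => d0 x) hφ
  have hcomp : IsCompact (range φ) := isCompact_range hφc
  -- The deviation `2 * ε` is the slack `ε` at the median plus the radius `ε` of the neighbourhood.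
  -- The lower tail is the upper tail of `-φ`.
  have h1 := haarProb_setOf_add_le_le K hd d0 hconc hφ
    (half_le_measure_le_median_add (haarProb K) hcomp.bddAbove hε)
  have h2 := haarProb_setOf_add_le_le K hd d0 hconc (φ := fun x => -φ x)
    (fun x y => by rw [neg_sub_neg, abs_sub_comm]; exact hφ x y)
    (c := -(median (haarProb K) φ - ε))
    (by simpa only [neg_le_neg_iff] using
      half_le_measure_median_sub_le (haarProb K) hcomp.bddBelow hε)
  refine (measure_mono fun x hx => ?_).trans ((measure_union_le _ _).trans (add_le_add h1 h2))
  rcases lt_abs.1 (show 2 * ε < |φ x - median (haarProb K) φ| from hx) with h | h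
  · left
    rw [mem_ofPred_eq]
    linarith
  · right
    rw [mem_ofPred_eq]
    linarith

/-! ### Bounding Gromov's distance -/

theorem me₁_le {u v : unitInterval → ℝ} {l : ℝ} (hl : 0 < l)
    (h : (volume : Measure unitInterval) {t | l < |u t - v t|} < ENNReal.ofReal l) :
    me₁ u v ≤ ENNReal.ofReal l :=
  iInf₂_le l ⟨hl, h⟩

theorem hausdorffMe₁_le {A B : Set (unitInterval → ℝ)} {r : ℝ≥0∞}
    (hA : ∀ u ∈ A, ∃ v ∈ B, me₁ u v ≤ r) (hB : ∀ v ∈ B, ∃ u ∈ A, me₁ u v ≤ r) :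
    hausdorffMe₁ A B ≤ r := by
  refine sup_le (iSup₂_le fun u hu => ?_) (iSup₂_le fun v hv => ?_)
  · obtain ⟨v, hv, h⟩ := hA u hu
    exact (iInf₂_le v hv).trans h
  · obtain ⟨u, hu, h⟩ := hB v hv
    exact (iInf₂_le u hu).trans h

theorem gromovDist_le {X Y : Type*} [MeasurableSpace X] [MeasurableSpace Y]
    {d : X → X → ℝ} {μ : Measure X} {e : Y → Y → ℝ} {ν : Measure Y}
    {f : unitInterval → X} (hf : IsParam μ f) {g : unitInterval → Y} (hg : IsParam ν g) :
    gromovDist d μ e ν ≤ hausdorffMe₁ (lipSet d f) (lipSet e g) :=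
  (iInf₂_le f hf).trans (iInf₂_le g hg)


variable [TopologicalSpace.MetrizableSpace G]

/-- Independent Haar-random elements of two compact subgroups, realized on `[0, 1]`. -/
theorem exists_param_prod (H K : Subgroup G) [CompactSpace H] [CompactSpace K] :
    ∃ w : unitInterval → H × K, IsParam ((haarProb H).prod (haarProb K)) w := by
  have := polishSpace_subgroup H
  have := polishSpace_subgroup K
  exact Measure.exists_measurable_map_eq ((haarProb H).prod (haarProb K))

/-- The estimate for one subgroup: if 1-Lipschitz functions concentrate on `K`, then `H * K` is
close to `H`. -/
theorem gromovDist_haarConv_le (H K : Subgroup G) [CompactSpace H] [CompactSpace K]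
    {ρ : MetricSpace G} (hρ : IsCompatibleRightInvariant ρ)
    (hleft : ∀ h ∈ H, ∀ x y, ρ.dist (h * x) (h * y) = ρ.dist x y)
    {π : G → G} (hπ : ∀ x y, ρ.dist (π x) (π y) ≤ ρ.dist x y)
    (hπH : ∀ x, π x ∈ H) (hπHK : ∀ h ∈ H, ∀ k ∈ K, π (h * k) = h)
    {l : ℝ} (hl : 0 < l)
    (hconc : ∀ A, MeasurableSet A → 1 / 2 ≤ (haarProb K).map Subtype.val A →
      1 - ENNReal.ofReal (l / 4) < (haarProb K).map Subtype.val
        {x | ∃ a ∈ A, (x, a) ∈ {p : G × G | ρ.dist p.1 p.2 < l / 2}}) :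
    gromovDist
        (fun x y : ((H : Set G) * (K : Set G) : Set G) => ρ.dist (x : G) (y : G))
        (haarConv H K) (fun x y : H => ρ.dist (x : G) (y : G)) (haarProb H)
      ≤ ENNReal.ofReal l := by
  have := polishSpace_subgroup H
  have := polishSpace_subgroup K
  obtain ⟨w, hw, hwmap⟩ := exists_param_prod H K
  have hmul : Measurable (mulMap H K) := (continuous_mulMap H K).measurable
  -- The same `w` drives both parametrizations, so functions on the two spaces are compared
  -- pointwise.
  have hf : IsParam (haarConv H K) (mulMap H K ∘ w) :=
    ⟨hmul.comp hw, by rw [← Measure.map_map hmul hw, hwmap]; rfl⟩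
  have hg : IsParam (haarProb H) (Prod.fst ∘ w) :=
    ⟨measurable_fst.comp hw, by
      rw [← Measure.map_map measurable_fst hw, hwmap, Measure.map_fst_prod, measure_univ, one_smul]⟩
  refine (gromovDist_le hf hg).trans (hausdorffMe₁_le ?_ ?_)
  · rintro _ ⟨p, hp', rfl⟩
    have hp : ∀ x y, |p x - p y| ≤ ρ.dist (x : G) (y : G) := hp'
    have hd := hρ.continuous_dist
    have hsub : ∀ (h : H) (x y : K), |p (mulMap H K (h, x)) - p (mulMap H K (h, y))| ≤
        ρ.dist (x : G) (y : G) := fun h x y => by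
      have h1 := hp (mulMap H K (h, x)) (mulMap H K (h, y))
      rwa [show ρ.dist (mulMap H K (h, x) : G) (mulMap H K (h, y) : G) = ρ.dist (x : G) (y : G)
        from hleft h h.2 x y] at h1
    have hpc : Continuous p := continuous_of_abs_sub_le
      (d := fun x y : ((H : Set G) * (K : Set G) : Set G) => ρ.dist (x : G) (y : G))
      (hd.comp (continuous_subtype_val.prodMap continuous_subtype_val)) (fun x => ρ.dist_self x) hp
    have hpm : Continuous fun z => p (mulMap H K z) := hpc.comp (continuous_mulMap H K)
    let m : H → ℝ := fun h => median (haarProb K) fun k => p (mulMap H K (h, k))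
    have hbdd : ∀ h, IsCompact (range fun k => p (mulMap H K (h, k))) := fun h =>
      isCompact_range (hpm.comp (continuous_const.prodMk continuous_id))
    have hm : ∀ x y : H, |m x - m y| ≤ ρ.dist (x : G) (y : G) := by
      have hle : ∀ x y : H, m x ≤ m y + ρ.dist (x : G) (y : G) := fun x y => by
        refine median_le_median_add _ (hbdd x).bddBelow (hbdd y).bddAbove fun k => ?_
        have h1 := (le_abs_self _).trans (hp (mulMap H K (x, k)) (mulMap H K (y, k)))
        rw [show ρ.dist (mulMap H K (x, k) : G) (mulMap H K (y, k) : G) = ρ.dist (x : G) (y : G)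
          from hρ.2 x y k] at h1
        linarith
      intro x y
      have h1 := hle x y
      have h2 := hle y x
      rw [ρ.dist_comm] at h2
      rw [abs_le]
      constructor <;> linarith
    have hmc : Continuous m := continuous_of_abs_sub_le
      (d := fun x y : H => ρ.dist (x : G) (y : G))
      (hd.comp (continuous_subtype_val.prodMap continuous_subtype_val)) (fun x => ρ.dist_self x) hm
    refine ⟨m ∘ (Prod.fst ∘ w), ⟨m, hm, rfl⟩, me₁_le hl ?_⟩
    let S : Set (H × K) := {z | l < |p (mulMap H K z) - m z.1|}
    have hS : MeasurableSet S :=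
      (isOpen_lt continuous_const (hpm.sub (hmc.comp continuous_fst)).abs).measurableSet
    have hvol : (volume : Measure unitInterval)
        {t | l < |(p ∘ mulMap H K ∘ w) t - (m ∘ Prod.fst ∘ w) t|} =
        (haarProb H).prod (haarProb K) S := by
      rw [← hwmap, Measure.map_apply hw hS]
      rfl
    rw [hvol, Measure.prod_apply hS]
    -- By Fubini it suffices to bound each fibre. Radius `l / 2` gives deviation `l`, and two tails
    -- of mass `l / 4` give `l / 2`, strictly below `l` as `me₁` requires.
    calc ∫⁻ h, haarProb K (Prod.mk h ⁻¹' S) ∂haarProb H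
        ≤ ∫⁻ _, (ENNReal.ofReal (l / 4) + ENNReal.ofReal (l / 4)) ∂haarProb H := by
          refine lintegral_mono fun h => ?_
          have h1 := haarProb_setOf_lt_abs_sub_median_le K hd ρ.dist_self (half_pos hl) hconc
            (hsub h)
          rwa [mul_div_cancel₀ l two_ne_zero] at h1
      _ = ENNReal.ofReal (l / 2) := by
          rw [lintegral_const, measure_univ, mul_one, ← ENNReal.ofReal_add (by positivity)
            (by positivity)]
          congr 1; ring
      _ < ENNReal.ofReal l := (ENNReal.ofReal_lt_ofReal_iff hl).2 (half_lt_self hl)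
  · rintro _ ⟨q, hq, rfl⟩
    let p : ((H : Set G) * (K : Set G) : Set G) → ℝ := fun x => q ⟨π x, hπH x⟩
    refine ⟨p ∘ (mulMap H K ∘ w), ⟨p, fun x y => (hq _ _).trans (hπ x y), rfl⟩, me₁_le hl ?_⟩
    have heq : ∀ t, p (mulMap H K (w t)) = q (w t).1 := fun t => by
      have : π (mulMap H K (w t)) = (w t).1 := hπHK _ (w t).1.2 _ (w t).2.2
      simp only [p, this]
    have hempty : {t | l < |(p ∘ mulMap H K ∘ w) t - (q ∘ Prod.fst ∘ w) t|} = ∅ :=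
      eq_empty_of_forall_notMem fun t ht => by
        have h1 : l < |p (mulMap H K (w t)) - q (w t).1| := ht
        rw [heq, sub_self, abs_zero] at h1
        exact lt_asymm hl h1
    rw [hempty, measure_empty]
    exact ENNReal.ofReal_pos.2 hl

end Concentration

theorem mainTheorem10 {G : Type*} [Group G] [TopologicalSpace G] [IsTopologicalGroup G]
    [TopologicalSpace.MetrizableSpace G] [MeasurableSpace G] [BorelSpace G]
    (H N : Subgroup G) [CompactSpace H] (hHN : Concentration.IsSemidirect H N)
    {ι : Type*} [Preorder ι] [IsDirected ι (· ≤ ·)]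
    (K : ι → Subgroup G) [∀ α, CompactSpace (K α)] (hK : Concentration.IsLevyVia N K) :
    (∃ ρ : MetricSpace G, Concentration.IsCompatibleRightInvariant ρ ∧
      Tendsto (fun α => Concentration.gromovDist
        (fun x y : ((H : Set G) * (K α : Set G) : Set G) => ρ.dist (x : G) (y : G))
        (Concentration.haarConv H (K α))
        (fun x y : H => ρ.dist (x : G) (y : G))
        (Concentration.haarProb H)) atTop (𝓝 0)) ∧
    ((∀ α, ∀ h ∈ H, ∀ k ∈ K α, h * k * h⁻¹ ∈ K α) →
      ∀ α, ∃ L : Subgroup G, (L : Set G) = (H : Set G) * (K α : Set G) ∧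
        IsCompact (L : Set G)) := by
  refine ⟨?_, fun hconj α => Concentration.exists_compact_subgroup_eq_mul H (K α) (hconj α)⟩
  obtain ⟨π, hπc, hπmem, hπH, hπN⟩ := hHN.exists_projection
  obtain ⟨ρ, hρ, hleft, hπ⟩ := Concentration.exists_metric_of_retraction H π hπc
    (fun x => hπH _ (hπmem x)) hπH
  refine ⟨ρ, hρ, ENNReal.tendsto_nhds_zero.2 fun ε hε => ?_⟩
  obtain ⟨l, -, hl, hlε⟩ := ENNReal.lt_iff_exists_real_btwn.1 hε
  have hl' : 0 < l := ENNReal.ofReal_pos.1 hl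
  let := IsTopologicalGroup.rightUniformSpace G
  -- The threshold `1 / 2` fits the sublevel and superlevel sets at the median.
  filter_upwards [hK.concentrates.eventually_forall (c := 1 / 2)
    (r := 1 - ENNReal.ofReal (l / 4)) (by simp) (by simp)
    (ENNReal.sub_lt_self (by simp) (by simp) (by simpa using hl'))
    (hρ.mem_uniformity (half_pos hl'))] with α hα
  exact (Concentration.gromovDist_haarConv_le H (K α) hρ hleft hπ hπmem
    (fun h hh k hk => by rw [map_mul, hπH h hh, hπN k (hK.le α hk), mul_one]) hl' hα).trans hlε.le
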